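/- Let $\Lambda=(\Lambda_{ij})$ be a positive-definite symmetric real $4\times4$ matrix with $\Lambda_{ii}=1$ for $i=1,\dots,4$. For every such matrix let $F(\Lambda)=E[\max(X_1,X_2,X_3,X_4)]$, where $X=(X_1,X_2,X_3,X_4)$ is a centered Gaussian random vector with covariance matrix $\Lambda$, and regard $F$ as a function of the six variables $\Lambda_{kl}$, $1\le k<l\le 4$ (so that $\Lambda_{lk}=\Lambda_{kl}$ varies together with $\Lambda_{kl}$). Put $\Lambda'_{ij}=1-\Lambda_{ij}$ and $\tilde A=6\sqrt2\,\mathcal V$, where $\mathcal V$ is the volume of the tetrahedron in $L^2$ with vertices $X_1,X_2,X_3,X_4$. For $k<l$ let $m<n$ be the two elements of $\{1,2,3,4\}\setminus\{k,l\}$ and put $$\tilde\Lambda_{kl}=(\Lambda'_{kl})^2-\Lambda'_{kl}\bigl[\Lambda'_{km}+\Lambda'_{kn}+\Lambda'_{lm}+\Lambda'_{ln}-2\Lambda'_{mn}\bigr]+\bigl[\Lambda'_{km}-\Lambda'_{lm}\bigr]\bigl[\Lambda'_{kn}-\Lambda'_{ln}\bigr].$$ Then for all $k<l$ one has $\Lambda'_{kl}>0$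 and $\Lambda'_{kl}\tilde A^2+\tilde\Lambda_{kl}^2>0$, the partial derivative of $F$ with respect to $\Lambda_{kl}$ exists at $\Lambda$, and $$\frac{\partial F}{\partial\Lambda_{kl}}(\Lambda)=-\frac{1}{4\sqrt{\pi^3\Lambda'_{kl}}}\arccos\left(\frac{\tilde\Lambda_{kl}}{\sqrt{\Lambda'_{kl}\tilde A^2+\tilde\Lambda_{kl}^2}}\right);$$ in particular $\frac{\partial F}{\partial\Lambda_{kl}}(\Lambda)<0$. -/

import Mathlib

open MeasureTheory ProbabilityTheory
open scoped ENNReal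

noncomputable section

/-- The covariance matrices of centered four-dimensional Gaussian vectors with unit variances that
are non-degenerate: positive-definite (in particular symmetric) real `4 × 4` matrices all of whose
diagonal entries are `1`. -/
def UnitPosDef : Set (Matrix (Fin 4) (Fin 4) ℝ) :=
  {L | L.PosDef ∧ ∀ i, L i i = 1}

/-- `E[max(X₁, X₂, X₃, X₄)]` for a four-dimensional random vector `X` on `(Ω, P)`. -/
def expectedMax {Ω : Type*} [MeasurableSpace Ω] (P : Measure Ω)
    (X : Ω → EuclideanSpace ℝ (Fin 4)) : ℝ :=
  ∫ ω, max (max (X ω 0) (X ω 1)) (max (X ω 2) (X ω 3)) ∂P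

/-- The function `F(Λ) = E[max(X₁, X₂, X₃, X₄)]`, where `X` is a centered Gaussian vector with
covariance matrix `Λ`; it is realized here as the identity vector under the Gaussian law
`N(0, Λ)`. See `expectedMax_eq` for the independence of the realization. -/
def gaussianMax (L : Matrix (Fin 4) (Fin 4) ℝ) : ℝ :=
  expectedMax (multivariateGaussian (0 : EuclideanSpace ℝ (Fin 4)) L) id

/-- A centered Gaussian vector with covariance matrix `Λ` has law `N(0, Λ)`. -/
theorem map_eq_multivariateGaussian {Ω : Type*} [MeasurableSpace Ω] {P : Measure Ω}
    {X : Ω → EuclideanSpace ℝ (Fin 4)} {L : Matrix (Fin 4) (Fin 4) ℝ} (hL : L.PosSemidef)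
    (hX : HasGaussianLaw X P) (hmean : ∫ ω, X ω ∂P = 0)
    (hcov : ∀ i j, cov[fun ω => X ω i, fun ω => X ω j; P] = L i j) :
    P.map X = multivariateGaussian 0 L := by
  have hG := hX.isGaussian_map
  apply IsGaussian.ext
  · rw [integral_map hX.aemeasurable (by fun_prop)]
    simpa using hmean
  rw [← ContinuousLinearMap.toBilinForm_inj]
  refine LinearMap.BilinForm.ext_basis (EuclideanSpace.basisFun (Fin 4) ℝ).toBasis fun i j => ?_
  rw [ContinuousLinearMap.toBilinForm_apply, ContinuousLinearMap.toBilinForm_apply,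
    covarianceBilin_apply_eq_cov IsGaussian.memLp_two_id, covariance_map]
  · have h (i : Fin 4) : (fun u => inner ℝ ((EuclideanSpace.basisFun (Fin 4) ℝ).toBasis i) u) ∘ X
        = fun ω => X ω i := by
      ext; simp [PiLp.inner_apply]
    rw [h, h, hcov, covarianceBilin_multivariateGaussian hL]
    simp
  · exact Measurable.aestronglyMeasurable (by fun_prop)
  · exact Measurable.aestronglyMeasurable (by fun_prop)
  · exact hX.aemeasurable

/-- `E[max(X₁, X₂, X₃, X₄)]` is the same for every centered Gaussian vector `X` with covariance
matrix `Λ`, on whatever probability space. -/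
theorem expectedMax_eq {Ω : Type*} [MeasurableSpace Ω] {P : Measure Ω}
    {X : Ω → EuclideanSpace ℝ (Fin 4)} {L : Matrix (Fin 4) (Fin 4) ℝ} (hL : L.PosSemidef)
    (hX : HasGaussianLaw X P) (hmean : ∫ ω, X ω ∂P = 0)
    (hcov : ∀ i j, cov[fun ω => X ω i, fun ω => X ω j; P] = L i j) :
    expectedMax P X = gaussianMax L := by
  unfold gaussianMax expectedMax
  rw [← map_eq_multivariateGaussian hL hX hmean hcov, integral_map hX.aemeasurable
    (Measurable.aestronglyMeasurable (by simp only [id]; fun_prop))]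
  rfl

/-- The volume of the tetrahedron with vertices `p 0, p 1, p 2, p 3` in a real inner product space
of arbitrary dimension: the three-dimensional Euclidean Hausdorff measure (normalized so that it is
Lebesgue measure on Euclidean three-space) of the convex hull of the vertices. -/
def tetrahedronVolume {E : Type*} [NormedAddCommGroup E] [InnerProductSpace ℝ E]
    (p : Fin 4 → E) : ℝ :=
  letI : MeasurableSpace E := borel E
  haveI : BorelSpace E := ⟨rfl⟩
  ((Measure.euclideanHausdorffMeasure 3 : Measure E) (convexHull ℝ (Set.range p))).toReal

theorem memLp_coord (L : Matrix (Fin 4) (Fin 4) ℝ) (i : Fin 4) :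
    MemLp (fun x : EuclideanSpace ℝ (Fin 4) => x i) 2
      (multivariateGaussian (0 : EuclideanSpace ℝ (Fin 4)) L) :=
  (EuclideanSpace.proj (𝕜 := ℝ) i).comp_memLp' IsGaussian.memLp_two_id

/-- The components `X₁, X₂, X₃, X₄` of a centered Gaussian vector with covariance matrix `Λ`, as
elements of the Hilbert space `L²`. -/
def gaussianVertex (L : Matrix (Fin 4) (Fin 4) ℝ) (i : Fin 4) :
    Lp ℝ 2 (multivariateGaussian (0 : EuclideanSpace ℝ (Fin 4)) L) :=
  (memLp_coord L i).toLp _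

/-- `Ã = 6 √2 V`, where `V` is the volume of the tetrahedron in `L²` with vertices
`X₁, X₂, X₃, X₄`. -/
def tildeA (L : Matrix (Fin 4) (Fin 4) ℝ) : ℝ :=
  6 * √2 * tetrahedronVolume (gaussianVertex L)

/-- `Λ'ₖₗ = 1 - Λₖₗ`. -/
def primeEntry (L : Matrix (Fin 4) (Fin 4) ℝ) (k l : Fin 4) : ℝ := 1 - L k l

/-- The smaller of the two indices different from `k` and `l`. -/
def restMin (k l : Fin 4) : Fin 4 := ({k, l}ᶜ : Finset (Fin 4)).inf id

/-- The larger of the two indices different from `k` and `l`. -/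
def restMax (k l : Fin 4) : Fin 4 := ({k, l}ᶜ : Finset (Fin 4)).sup id

/-- `Λ̃ₖₗ`, with `m < n` the two indices different from `k` and `l`. -/
def tildeEntry (L : Matrix (Fin 4) (Fin 4) ℝ) (k l : Fin 4) : ℝ :=
  let m := restMin k l
  let n := restMax k l
  primeEntry L k l ^ 2
    - primeEntry L k l * (primeEntry L k m + primeEntry L k n + primeEntry L l m
        + primeEntry L l n - 2 * primeEntry L m n)
    + (primeEntry L k m - primeEntry L l m) * (primeEntry L k n - primeEntry L l n)

/-- The symmetric matrix direction that moves the entry `Λₖₗ` (and hence `Λₗₖ`) at unit speed and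
keeps all other entries fixed. -/
def entryDirection (k l : Fin 4) : Matrix (Fin 4) (Fin 4) ℝ :=
  Matrix.single k l 1 + Matrix.single l k 1

end

/-! Write `L = V Vᵀ`, so that `Xᵢ = Vᵢ · x` with `x` standard Gaussian. Let `V Q = eₖ` and `V S =
eₗ`. Moving only the row `Vₗ` by `t Q + h(t) S` changes `Λₖₗ` by `t` and no other covariance,
provided `h` is chosen to keep the variance of `Xₗ` fixed; this forces `h(t) = O(t²)`
(`exists_small_root`, `updated_mul_transpose`). Since ties are null, differentiating under the
integral gives `∂F/∂Λₖₗ = E[Q · x; Xₗ is the maximum]` (`hasDerivAt_gaussianMax`).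

By Gram–Schmidt, `V` can be chosen so that the edges `Vₗ - Vₘ`, `Vₗ - Vₙ`, `Vₗ - Vₖ` are triangular
with positive diagonal `r00, r11, r22` (`exists_triangular_coordinates`). Then `Q = (0, 0, -1/r22,
*)` and the event is a simplicial cone in the first three coordinates. The last coordinate averages
to zero, the third integrates to a Gaussian density at the boundary of the cone, and what remains is
a Gaussian integral over a plane sector, that is, an angle (`integral_indicator_cone_stdGaussian`).

Since `Λ'` is half a squared edge length and `Ã² = 2 (r00 r11 r22)²` by the Gram formula for the
volume, this angle is the stated arccosine. It is positive because the tetrahedron is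
non-degenerate. -/

/-! ### Linear images of the standard Gaussian -/

/-- The image of the standard Gaussian measure under a matrix `A` is `N(0, A Aᵀ)`. -/
theorem stdGaussian_map_toEuclideanCLM {ι : Type*} [Fintype ι] [DecidableEq ι]
    (A : Matrix ι ι ℝ) :
    (stdGaussian (EuclideanSpace ℝ ι)).map (Matrix.toEuclideanCLM (𝕜 := ℝ) A)
      = multivariateGaussian 0 (A * A.transpose) := by
  have hA : (A * A.transpose).PosSemidef := by
    simpa using Matrix.posSemidef_self_mul_conjTranspose A
  apply IsGaussian.ext
  · simp only [id]
    rw [ContinuousLinearMap.integral_id_map IsGaussian.integrable_id]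
    simp
  · ext x y
    rw [covarianceBilin_map IsGaussian.memLp_two_id, covarianceBilin_stdGaussian,
      covarianceBilin_multivariateGaussian hA, innerSL_apply_apply, ← ContinuousLinearMap.star_eq_adjoint,
      ← map_star, PiLp.inner_apply]
    rw [← Matrix.mulVec_mulVec, Matrix.dotProduct_mulVec]
    simp [Matrix.star_eq_conjTranspose, Matrix.mulVec_transpose, dotProduct, mul_comm]

theorem gaussianMax_mul_transpose (A : Matrix (Fin 4) (Fin 4) ℝ) :
    gaussianMax (A * A.transpose) = ∫ x, (fun v : Fin 4 → ℝ => max (max (v 0) (v 1)) (max (v 2) (v 3)))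
      (A.mulVec x.ofLp) ∂(stdGaussian (EuclideanSpace ℝ (Fin 4))) := by
  unfold gaussianMax expectedMax
  rw [← stdGaussian_map_toEuclideanCLM, integral_map (by fun_prop)
    (Measurable.aestronglyMeasurable (by simp only [id]; fun_prop))]
  simp [Matrix.ofLp_toEuclideanCLM]

/-- The functional is a real Gaussian of variance `‖w‖² ≠ 0`, hence has no atoms. Applied to
differences of rows, it shows that ties with `Xₗ` are negligible. -/
theorem ae_stdGaussian_inner_ne_zero {E : Type*} [NormedAddCommGroup E] [InnerProductSpace ℝ E]
    [FiniteDimensional ℝ E] [MeasurableSpace E] [BorelSpace E] {w : E} (hw : w ≠ 0) :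
    ∀ᵐ x ∂(stdGaussian E), inner ℝ w x ≠ 0 := by
  have h : (stdGaussian E).map (innerSL ℝ w) = gaussianReal 0 (‖w‖ ^ 2).toNNReal := by
    rw [IsGaussian.map_eq_gaussianReal, integral_strongDual_stdGaussian, variance_dual_stdGaussian,
      innerSL_apply_norm]
  have hv : (‖w‖ ^ 2).toNNReal ≠ 0 := by
    simp [hw]
  have := nullSingletonClass_gaussianReal (μ := 0) hv
  have h0 : gaussianReal 0 (‖w‖ ^ 2).toNNReal {0} = 0 := measure_singleton 0
  rw [← h, Measure.map_apply (by fun_prop) (measurableSet_singleton 0)] at h0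
  rw [ae_iff]
  simpa [Set.preimage] using h0
-- Differentiating the expectation of a maximum
open Filter Topology in
/-- Differentiation under the integral sign of `t ↦ ∫ max (f + t q + h(t) s) M` at `0`, where `h`
vanishes to second order. -/
theorem hasDerivAt_integral_max {Ω : Type*} [MeasurableSpace Ω] {μ : Measure Ω}
    {f q s M : Ω → ℝ} (hf : Integrable f μ) (hq : Integrable q μ) (hs : Integrable s μ)
    (hM : Integrable M μ) (hne : ∀ᵐ ω ∂μ, f ω ≠ M ω) {h : ℝ → ℝ} (h0 : h 0 = 0)
    (hh : HasDerivAt h 0 0) :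
    HasDerivAt (fun t => ∫ ω, max (f ω + (t * q ω + h t * s ω)) (M ω) ∂μ)
      (∫ ω, {ω | M ω < f ω}.indicator q ω ∂μ) 0 := by
  -- Gives the difference quotients the integrable bound `|q| + |s|`.
  have hbd : ∀ᶠ t in 𝓝 (0 : ℝ), |h t| ≤ |t| := by
    have := (hasDerivAt_iff_isLittleO.1 hh).def one_pos
    filter_upwards [this] with t ht
    simpa [h0] using ht
  have hlip : ∀ a b c : ℝ, |max a c - max b c| ≤ |a - b| := fun a b c => by
    simpa using abs_max_sub_max_le_max a c b c
  have hmeas : AEStronglyMeasurable ({ω | M ω < f ω}.indicator q) μ :=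
    hq.1.indicator₀ (nullMeasurableSet_lt hM.1.aemeasurable hf.1.aemeasurable)
  have key := hasFDerivAt_integral_of_dominated_loc_of_lip' (𝕜 := ℝ) (μ := μ)
    (F := fun t ω => max (f ω + (t * q ω + h t * s ω)) (M ω)) (x₀ := (0 : ℝ))
    (F' := fun ω => ContinuousLinearMap.toSpanSingleton ℝ ({ω | M ω < f ω}.indicator q ω))
    (bound := fun ω => |q ω| + |s ω|) hbd
    (fun t _ => ((hf.add ((hq.const_mul t).add (hs.const_mul (h t)))).sup hM).1)
    (((hf.add ((hq.const_mul 0).add (hs.const_mul (h 0)))).sup hM))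
    (by
      exact (ContinuousLinearMap.toSpanSingletonCLE (𝕜 := ℝ) (E := ℝ)).continuous.comp_aestronglyMeasurable hmeas)
    (by
      refine Eventually.of_forall fun ω t ht => ?_
      rw [Real.norm_eq_abs]
      refine (hlip _ _ _).trans ?_
      simp only [h0, zero_mul, add_zero, add_sub_cancel_left, sub_zero, Real.norm_eq_abs]
      have ht' : |h t| ≤ |t| := ht
      refine (abs_add_le _ _).trans ?_
      rw [abs_mul, abs_mul]
      have : |h t| * |s ω| ≤ |t| * |s ω| := by gcongr
      linarith)
    (hq.abs.add hs.abs)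
    (by
      filter_upwards [hne] with ω hω
      have hg : HasDerivAt (fun t => f ω + (t * q ω + h t * s ω)) (q ω) 0 := by
        simpa using (((hasDerivAt_id (0 : ℝ)).mul_const (q ω)).add (hh.mul_const (s ω))).const_add (f ω)
      have hg0 : f ω + (0 * q ω + h 0 * s ω) = f ω := by simp [h0]
      rw [← hasDerivAt_iff_hasFDerivAt]
      -- Off the tie set the same argument of the maximum wins for all small `t`.
      rcases lt_or_gt_of_ne hω with hlt | hgt
      · rw [Set.indicator_of_notMem (by simpa using hlt.le)]
        refine (hasDerivAt_const (0 : ℝ) (M ω)).congr_of_eventuallyEq ?_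
        have := hg.continuousAt.eventually_lt (continuousAt_const (y := M ω)) (by simpa [h0] using hlt)
        filter_upwards [this] with t ht using max_eq_right ht.le
      · rw [Set.indicator_of_mem (by simpa using hgt)]
        refine hg.congr_of_eventuallyEq ?_
        have := (continuousAt_const (y := M ω)).eventually_lt hg.continuousAt (by simpa [h0] using hgt)
        filter_upwards [this] with t ht using max_eq_left ht.le)
  have := key.2.hasDerivAt
  rwa [ContinuousLinearMap.integral_apply key.1, integral_congr_ae (g := {ω | M ω < f ω}.indicator q)
    (by simp)] at this

/-! ### Volume of the tetrahedron as a Gram determinant -/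

open Set in
/-- The corner simplex `{x ≥ 0, ∑ x ≤ r}` in `ℝⁿ` has volume `rⁿ / n!`. -/
theorem volume_cornerSimplex (n : ℕ) {r : ℝ} (hr : 0 ≤ r) :
    volume {x : Fin n → ℝ | (∀ i, 0 ≤ x i) ∧ ∑ i, x i ≤ r} = ENNReal.ofReal (r ^ n / n.factorial) := by
  induction n generalizing r with
  | zero => simp [hr, volume_pi]
  | succ n ih =>
    have hmeas : MeasurableSet {x : Fin (n + 1) → ℝ | (∀ i, 0 ≤ x i) ∧ ∑ i, x i ≤ r} := by
      measurability
    have hp := (volume_preserving_piFinSuccAbove (fun _ : Fin (n + 1) => ℝ) 0).symm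
    rw [← hp.measure_preimage hmeas.nullMeasurableSet, Measure.volume_eq_prod,
      Measure.prod_apply (hp.measurable hmeas)]
    -- Fixing the first coordinate at `a` leaves the corner simplex of size `r - a`, empty unless `0
    -- ≤ a ≤ r`.
    have hslice : ∀ a : ℝ, volume (Prod.mk a ⁻¹' ((MeasurableEquiv.piFinSuccAbove (fun _ : Fin (n + 1) => ℝ) 0).symm ⁻¹'
        {x : Fin (n + 1) → ℝ | (∀ i, 0 ≤ x i) ∧ ∑ i, x i ≤ r}))
        = (Icc 0 r).indicator (fun a => ENNReal.ofReal ((r - a) ^ n / n.factorial)) a := by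
      intro a
      have hset : Prod.mk a ⁻¹' ((MeasurableEquiv.piFinSuccAbove (fun _ : Fin (n + 1) => ℝ) 0).symm ⁻¹'
          {x : Fin (n + 1) → ℝ | (∀ i, 0 ≤ x i) ∧ ∑ i, x i ≤ r})
          = {y : Fin n → ℝ | 0 ≤ a ∧ (∀ i, 0 ≤ y i) ∧ ∑ i, y i ≤ r - a} := by
        ext y
        simp [MeasurableEquiv.piFinSuccAbove, Fin.forall_fin_succ, Fin.sum_univ_succ, and_assoc,
          le_sub_iff_add_le']
      rw [hset]
      by_cases ha : a ∈ Icc 0 r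
      · rw [indicator_of_mem ha, ← ih (sub_nonneg.2 ha.2)]
        simp [ha.1]
      · rw [indicator_of_notMem ha]
        convert measure_empty (μ := volume)
        rw [eq_empty_iff_forall_notMem]
        rintro y ⟨h0, hy, hs⟩
        exact ha ⟨h0, by linarith [Finset.sum_nonneg fun i (_ : i ∈ Finset.univ) => hy i]⟩
    simp_rw [hslice]
    rw [lintegral_indicator measurableSet_Icc, ← ofReal_integral_eq_lintegral_ofReal]
    · congr 1
      rw [integral_Icc_eq_integral_Ioc, ← intervalIntegral.integral_of_le hr,
        intervalIntegral.integral_comp_sub_left (fun x => x ^ n / (n.factorial : ℝ)) r]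
      simp [Nat.factorial_succ]
      field_simp
    · exact (Continuous.integrableOn_Icc (by fun_prop))
    · refine (ae_restrict_iff' measurableSet_Icc).2 (Filter.Eventually.of_forall fun a ha => ?_)
      have := sub_nonneg.2 ha.2
      positivity

-- Barycentric coordinates with the weight of `p 0` eliminated: the tetrahedron is a translated
-- linear image of the corner simplex, so its volume can be read off from `normDet`.
open Set in
theorem convexHull_range_fin_four {E : Type*} [NormedAddCommGroup E] [InnerProductSpace ℝ E]
    (p : Fin 4 → E) (f : EuclideanSpace ℝ (Fin 3) →ₗ[ℝ] E)
    (hf : ∀ x, f x = ∑ i : Fin 3, x i • (p i.succ - p 0)) :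
    convexHull ℝ (range p) = (fun v => p 0 + v) ''
      (f '' (WithLp.ofLp ⁻¹' {x : Fin 3 → ℝ | (∀ i, 0 ≤ x i) ∧ ∑ i, x i ≤ 1})) := by
  have : range p = (Fintype.linearCombination ℝ p) '' range fun i : Fin 4 ↦ Pi.single i 1 := by
    rw [← range_comp]; congr 1; ext i; simp
  rw [this, ← LinearMap.image_convexHull, convexHull_rangle_single_eq_stdSimplex, image_image]
  ext v
  constructor
  · rintro ⟨w, ⟨hw, hs⟩, rfl⟩
    refine ⟨WithLp.toLp 2 fun i => w i.succ, ⟨fun i => hw _, ?_⟩, ?_⟩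
    · rw [Fin.sum_univ_succ] at hs
      have := hw 0
      simp only
      linarith
    · beta_reduce
      rw [hf]
      simp only [Fintype.linearCombination_apply, smul_sub, Finset.sum_sub_distrib, ← Finset.sum_smul]
      rw [Fin.sum_univ_succ] at hs
      rw [Fin.sum_univ_succ (f := fun i => w i • p i)]
      rw [show w 0 = 1 - ∑ i : Fin 3, w i.succ by linarith, sub_smul, one_smul]
      abel
  · rintro ⟨x, ⟨hx, hs⟩, rfl⟩
    refine ⟨Fin.cons (1 - ∑ i, x i) x.ofLp, ⟨?_, ?_⟩, ?_⟩
    · intro i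
      refine Fin.cases ?_ (fun i => ?_) i
      · simpa using hs
      · simpa using hx i
    · simp [Fin.sum_univ_succ]
    · beta_reduce
      rw [hf]
      simp only [Fintype.linearCombination_apply, smul_sub, Finset.sum_sub_distrib, ← Finset.sum_smul]
      rw [Fin.sum_univ_succ (f := fun i => (Fin.cons (1 - ∑ i, x i) x.ofLp : Fin 4 → ℝ) i • p i)]
      simp only [Fin.cons_zero, Fin.cons_succ, sub_smul, one_smul]
      abel

/-- The square of six times the volume of a tetrahedron is a Gram determinant. -/
theorem sq_six_mul_tetrahedronVolume {E : Type*} [NormedAddCommGroup E] [InnerProductSpace ℝ E]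
    (p : Fin 4 → E) :
    (6 * tetrahedronVolume p) ^ 2
      = (Matrix.gram ℝ fun i : Fin 3 => p i.succ - p 0).det := by
  let _ : MeasurableSpace E := borel E
  have : BorelSpace E := ⟨rfl⟩
  let f : EuclideanSpace ℝ (Fin 3) →ₗ[ℝ] E :=
    (Fintype.linearCombination ℝ fun i : Fin 3 => p i.succ - p 0) ∘ₗ
      (WithLp.linearEquiv 2 ℝ (Fin 3 → ℝ)).toLinearMap
  have hf : ∀ x, f x = ∑ i : Fin 3, x i • (p i.succ - p 0) := fun x => by
    simp [f, Fintype.linearCombination_apply]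
  have hvol : tetrahedronVolume p = f.normDet * (1 / 6) := by
    unfold tetrahedronVolume
    rw [convexHull_range_fin_four p f hf]
    rw [(isometry_add_left (p 0)).euclideanHausdorffMeasure_image]
    have h := f.euclideanHausdorffMeasure_image_eq_normDet_mul_volume
      (WithLp.ofLp ⁻¹' {x : Fin 3 → ℝ | (∀ i, 0 ≤ x i) ∧ ∑ i, x i ≤ 1})
    rw [finrank_euclideanSpace_fin] at h
    rw [h, (PiLp.volume_preserving_ofLp (Fin 3)).measure_preimage,
      volume_cornerSimplex 3 zero_le_one, ENNReal.toReal_mul,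
      ENNReal.toReal_ofReal f.normDet_nonneg, ENNReal.toReal_ofReal (by positivity)]
    · norm_num [Nat.factorial]
    · exact MeasurableSet.nullMeasurableSet (by measurability)
  have hb : ∀ i, f (EuclideanSpace.basisFun (Fin 3) ℝ i) = p i.succ - p 0 := fun i => by
    simp [hf]
  have hg := f.normDet_sq_eq_det_gram (EuclideanSpace.basisFun (Fin 3) ℝ)
  simp only [hb] at hg
  rw [hvol, ← hg]
  simp
  ring

/-! ### Gaussian integrals over half-lines, sectors and cones -/

open Set Filter Topology in
/-- `∫_c^∞ du / (A + 2 B u + C u²)` for a positive definite quadratic form. -/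
theorem lintegral_Ioi_inv_quadratic {A B C : ℝ} (hC : 0 < C) (hδ : 0 < A * C - B ^ 2) (c : ℝ) :
    ∫⁻ u in Ioi c, ENNReal.ofReal (1 / (A + 2 * B * u + C * u ^ 2)) = ENNReal.ofReal
      ((Real.pi / 2 - Real.arctan ((C * c + B) / √(A * C - B ^ 2))) / √(A * C - B ^ 2)) := by
  set δ := √(A * C - B ^ 2)
  have hδ0 : 0 < δ := Real.sqrt_pos.2 hδ
  have hδ2 : δ ^ 2 = A * C - B ^ 2 := Real.sq_sqrt hδ.le
  have hpos : ∀ u, 0 < A + 2 * B * u + C * u ^ 2 := fun u => by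
    -- Completing the square: `C (A + 2Bu + Cu²) = (Cu + B)² + (AC - B²)`.
    have : 0 < C * (A + 2 * B * u + C * u ^ 2) := by nlinarith [sq_nonneg (C * u + B)]
    exact pos_of_mul_pos_right this hC.le
  have hd : ∀ u ∈ Ici c, HasDerivAt (fun u => Real.arctan ((C * u + B) / δ) / δ)
      (1 / (A + 2 * B * u + C * u ^ 2)) u := fun u _ => by
    have h1 : HasDerivAt (fun u => (C * u + B) / δ) (C / δ) u := by
      simpa using (((hasDerivAt_id u).const_mul C).add_const B).div_const δ
    refine (h1.arctan.div_const δ).congr_deriv ?_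
    have := (hpos u).ne'
    have hne : δ ^ 2 + (C * u + B) ^ 2 = C * (A + 2 * B * u + C * u ^ 2) := by rw [hδ2]; ring
    have hsq : 1 + ((C * u + B) / δ) ^ 2 = C * (A + 2 * B * u + C * u ^ 2) / δ ^ 2 := by
      rw [← hne]; field_simp
    rw [hsq]
    field_simp
  have hlim : Tendsto (fun u => Real.arctan ((C * u + B) / δ) / δ) atTop (𝓝 (Real.pi / 2 / δ)) := by
    refine Tendsto.div_const ?_ _
    refine (tendsto_nhds_of_tendsto_nhdsWithin Real.tendsto_arctan_atTop).comp ?_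
    refine Tendsto.atTop_div_const hδ0 ?_
    exact tendsto_atTop_add_const_right _ _ (tendsto_id.const_mul_atTop hC)
  have hnn : ∀ u ∈ Ioi c, 0 ≤ 1 / (A + 2 * B * u + C * u ^ 2) := fun u _ => (one_div_pos.2 (hpos u)).le
  rw [← ofReal_integral_eq_lintegral_ofReal (integrableOn_Ioi_deriv_of_nonneg' hd hnn hlim)
    (ae_restrict_of_forall_mem measurableSet_Ioi hnn),
    integral_Ioi_of_hasDerivAt_of_nonneg' hd hnn hlim]
  congr 1
  ring

open Set Filter Topology in
theorem lintegral_Ioi_mul_exp {b : ℝ} (hb : 0 < b) :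
    ∫⁻ x in Ioi 0, ENNReal.ofReal (x * Real.exp (-(x ^ 2 * b) / 2)) = ENNReal.ofReal (1 / b) := by
  have hd : ∀ u ∈ Ici (0 : ℝ), HasDerivAt (fun x => -Real.exp (-(x ^ 2 * b) / 2) / b)
      (u * Real.exp (-(u ^ 2 * b) / 2)) u := fun u _ => by
    have h1 : HasDerivAt (fun x : ℝ => -(x ^ 2 * b) / 2) (-(2 * u * b) / 2) u := by
      simpa using (((hasDerivAt_pow 2 u).mul_const b).neg.div_const 2)
    refine (h1.exp.neg.div_const b).congr_deriv ?_
    field_simp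
  have hlim : Tendsto (fun x => -Real.exp (-(x ^ 2 * b) / 2) / b) atTop (𝓝 (-0 / b)) := by
    refine (Tendsto.neg (Real.tendsto_exp_atBot.comp ?_)).div_const b
    refine Tendsto.atBot_div_const two_pos (tendsto_neg_atTop_atBot.comp ?_)
    exact (tendsto_pow_atTop two_ne_zero).atTop_mul_const hb
  have hnn : ∀ u ∈ Ioi (0 : ℝ), 0 ≤ u * Real.exp (-(u ^ 2 * b) / 2) := fun u hu =>
    mul_nonneg (le_of_lt hu) (Real.exp_pos _).le
  rw [← ofReal_integral_eq_lintegral_ofReal (integrableOn_Ioi_deriv_of_nonneg' hd hnn hlim)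
    (ae_restrict_of_forall_mem measurableSet_Ioi hnn),
    integral_Ioi_of_hasDerivAt_of_nonneg' hd hnn hlim]
  congr 1
  simp
  field_simp

open Set in
/-- The integral of `exp (-(A x² + 2 B x y + C y²) / 2)` over the sector `x > 0`, `y > c x`. -/
theorem lintegral_sector_exp {A B C : ℝ} (hC : 0 < C) (hδ : 0 < A * C - B ^ 2) (c : ℝ) :
    ∫⁻ x in Ioi 0, ∫⁻ y in Ioi (c * x),
        ENNReal.ofReal (Real.exp (-(A * x ^ 2 + 2 * B * x * y + C * y ^ 2) / 2)) = ENNReal.ofReal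
      ((Real.pi / 2 - Real.arctan ((C * c + B) / √(A * C - B ^ 2))) / √(A * C - B ^ 2)) := by
  have hpos : ∀ u, 0 < A + 2 * B * u + C * u ^ 2 := fun u => by
    have : 0 < C * (A + 2 * B * u + C * u ^ 2) := by nlinarith [sq_nonneg (C * u + B)]
    exact pos_of_mul_pos_right this hC.le
  -- The substitution `y = u x` with Jacobian `x` turns the sector into the product `x > 0`, `u >
  -- c`.
  have hsub : ∀ x ∈ Ioi (0 : ℝ), ∫⁻ y in Ioi (c * x),
      ENNReal.ofReal (Real.exp (-(A * x ^ 2 + 2 * B * x * y + C * y ^ 2) / 2))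
      = ∫⁻ u in Ioi c, ENNReal.ofReal (x * Real.exp (-(x ^ 2 * (A + 2 * B * u + C * u ^ 2)) / 2)) := by
    intro x hx
    have hx : 0 < x := hx
    have himg : (fun u => u * x) '' Ioi c = Ioi (c * x) := by
      ext y
      simp only [mem_image, mem_Ioi]
      exact ⟨fun ⟨u, hu, h⟩ => h ▸ by gcongr, fun h => ⟨y / x, by rwa [lt_div_iff₀ hx], by field_simp⟩⟩
    rw [← himg, lintegral_image_eq_lintegral_abs_deriv_mul measurableSet_Ioi
      (fun u _ => (hasDerivAt_mul_const x).hasDerivWithinAt)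
      (fun a _ b _ h => mul_right_cancel₀ hx.ne' h)]
    refine lintegral_congr fun u => ?_
    rw [← ENNReal.ofReal_mul (abs_nonneg x), abs_of_pos hx]
    congr 3
    ring
  -- After the swap, the radial integral over `x` leaves the reciprocal of the quadratic in the
  -- slope `u`.
  rw [setLIntegral_congr_fun measurableSet_Ioi hsub, lintegral_lintegral_swap]
  · rw [← lintegral_Ioi_inv_quadratic hC hδ]
    exact lintegral_congr fun u => lintegral_Ioi_mul_exp (hpos u)
  · exact Measurable.aemeasurable (by unfold Function.uncurry; fun_prop)

theorem measurePreserving_vecCons_four (μ : Measure ℝ) [IsProbabilityMeasure μ] :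
    MeasurePreserving (fun z : (ℝ × ℝ) × ℝ × ℝ => ![z.1.1, z.1.2, z.2.1, z.2.2])
      ((μ.prod μ).prod (μ.prod μ)) (Measure.pi fun _ : Fin 4 => μ) where
  measurable := measurable_pi_iff.2 fun i => by fin_cases i <;> simp <;> fun_prop
  map_eq := by
    symm
    apply Measure.pi_eq
    intro s hs
    rw [Measure.map_apply (measurable_pi_iff.2 fun i => by fin_cases i <;> simp <;> fun_prop)
      (MeasurableSet.univ_pi hs)]
    have : (fun z : (ℝ × ℝ) × ℝ × ℝ => ![z.1.1, z.1.2, z.2.1, z.2.2]) ⁻¹' Set.univ.pi s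
        = (s 0 ×ˢ s 1) ×ˢ (s 2 ×ˢ s 3) := by
      ext z
      simp [Fin.forall_fin_succ, and_assoc]
    rw [this, Measure.prod_prod, Measure.prod_prod, Measure.prod_prod, Fin.prod_univ_four]
    ring

-- The standard Gaussian density `φ` satisfies `x φ(x) = -φ'(x)`.
open Set Filter Topology in
theorem setIntegral_Ioi_id_gaussianReal (c : ℝ) :
    ∫ x in Ioi c, x ∂(gaussianReal 0 1) = gaussianPDFReal 0 1 c := by
  have hp : ∀ x, gaussianPDFReal 0 1 x = (√(2 * Real.pi))⁻¹ * Real.exp (-(x ^ 2) / 2) := fun x => by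
    simp [gaussianPDFReal]
  have hd : ∀ x ∈ Ici c, HasDerivAt (fun x => -gaussianPDFReal 0 1 x) (gaussianPDFReal 0 1 x * x) x := by
    intro x _
    have h1 : HasDerivAt (fun x : ℝ => -(x ^ 2) / 2) (-(2 * x) / 2) x := by
      simpa using ((hasDerivAt_pow 2 x).neg.div_const 2)
    simp only [hp]
    refine (h1.exp.const_mul _).neg.congr_deriv ?_
    ring
  have hlim : Tendsto (fun x => -gaussianPDFReal 0 1 x) atTop (𝓝 (-((√(2 * Real.pi))⁻¹ * 0))) := by
    simp only [hp]
    refine (Tendsto.const_mul _ (Real.tendsto_exp_atBot.comp ?_)).neg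
    exact Tendsto.atBot_div_const two_pos (tendsto_neg_atTop_atBot.comp (tendsto_pow_atTop two_ne_zero))
  have hint : Integrable (fun x => gaussianPDFReal 0 1 x * x) := by
    have h : Integrable (fun x : ℝ => x) (gaussianReal 0 1) := IsGaussian.integrable_fun_id
    rw [gaussianReal_of_var_ne_zero 0 one_ne_zero, integrable_withDensity_iff_integrable_smul'
      (measurable_gaussianPDF 0 1) (ae_of_all _ fun _ => gaussianPDF_lt_top)] at h
    simpa [toReal_gaussianPDF] using h
  rw [← integral_indicator measurableSet_Ioi, integral_gaussianReal_eq_integral_smul one_ne_zero]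
  have := integral_Ioi_of_hasDerivAt_of_tendsto' hd hint.integrableOn hlim
  rw [← integral_indicator measurableSet_Ioi] at this
  simp only [mul_zero, neg_zero, zero_sub, neg_neg] at this
  rw [← this]
  congr 1
  ext x
  simp [indicator, mul_comm]

/-- The event does not involve the second coordinate, which is centered and independent, so the `β`
term vanishes. -/
theorem integral_indicator_linear_gaussianReal (α β c : ℝ) :
    ∫ z : ℝ × ℝ, {z : ℝ × ℝ | c < z.1}.indicator (fun z => α * z.1 + β * z.2) z
      ∂((gaussianReal 0 1).prod (gaussianReal 0 1)) = α * gaussianPDFReal 0 1 c := by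
  have hid : Integrable (fun x : ℝ => x) (gaussianReal 0 1) := IsGaussian.integrable_fun_id
  have h1 : Integrable ((Set.Ioi c).indicator fun x : ℝ => x) (gaussianReal 0 1) :=
    hid.indicator measurableSet_Ioi
  have h2 : Integrable ((Set.Ioi c).indicator fun _ : ℝ => (1 : ℝ)) (gaussianReal 0 1) :=
    (integrable_const 1).indicator measurableSet_Ioi
  have e : (fun z : ℝ × ℝ => {z : ℝ × ℝ | c < z.1}.indicator (fun z => α * z.1 + β * z.2) z)
      = fun z => α * ((Set.Ioi c).indicator (fun x : ℝ => x) z.1 * 1)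
        + β * ((Set.Ioi c).indicator (fun _ : ℝ => (1 : ℝ)) z.1 * z.2) := by
    ext z
    by_cases h : c < z.1 <;> simp [h]
  rw [e, integral_add ((h1.mul_prod (integrable_const 1)).const_mul α)
    ((h2.mul_prod hid).const_mul β), integral_const_mul, integral_const_mul,
    integral_prod_mul (f := (Set.Ioi c).indicator (fun x : ℝ => x)) (g := fun _ => (1 : ℝ)),
    integral_prod_mul (f := (Set.Ioi c).indicator (fun _ : ℝ => (1 : ℝ))) (g := fun x => x),
    integral_indicator measurableSet_Ioi, setIntegral_Ioi_id_gaussianReal, integral_id_gaussianReal]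
  simp

-- The product of the three densities at `x`, `y` and `g x + h y` is the exponential of a quadratic
-- form with `A = 1 + g²`, `B = g h`, `C = 1 + h²`, whose determinant is `1 + g² + h²`; the sector
-- formula applies.
open Set in
theorem integral_sector_gaussianPDFReal (c g h : ℝ) :
    ∫ z : ℝ × ℝ, {z : ℝ × ℝ | 0 < z.1 ∧ c * z.1 < z.2}.indicator
        (fun z => gaussianPDFReal 0 1 (g * z.1 + h * z.2)) z
      ∂((gaussianReal 0 1).prod (gaussianReal 0 1))
    = (√(2 * Real.pi))⁻¹ ^ 3 * ((Real.pi / 2 - Real.arctan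
      (((1 + h ^ 2) * c + g * h) / √(1 + g ^ 2 + h ^ 2))) / √(1 + g ^ 2 + h ^ 2)) := by
  have hmeas : MeasurableSet {z : ℝ × ℝ | 0 < z.1 ∧ c * z.1 < z.2} :=
    (measurableSet_lt measurable_const measurable_fst).inter
      (measurableSet_lt (measurable_fst.const_mul c) measurable_snd)
  have hm : Measurable ({z : ℝ × ℝ | 0 < z.1 ∧ c * z.1 < z.2}.indicator
        (fun z => gaussianPDFReal 0 1 (g * z.1 + h * z.2))) :=
    ((measurable_gaussianPDFReal 0 1).comp (by fun_prop)).indicator hmeas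
  have hδ : (1 + g ^ 2) * (1 + h ^ 2) - (g * h) ^ 2 = 1 + g ^ 2 + h ^ 2 := by ring
  have key := lintegral_sector_exp (A := 1 + g ^ 2) (B := g * h) (C := 1 + h ^ 2) (by positivity)
    (by rw [hδ]; positivity) c
  rw [hδ] at key
  have hnn : 0 ≤ (Real.pi / 2 - Real.arctan
      (((1 + h ^ 2) * c + g * h) / √(1 + g ^ 2 + h ^ 2))) / √(1 + g ^ 2 + h ^ 2) :=
    div_nonneg (sub_nonneg.2 (Real.arctan_lt_pi_div_two _).le) (Real.sqrt_nonneg _)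
  rw [integral_eq_lintegral_of_nonneg_ae (ae_of_all _ fun z => indicator_nonneg
    (fun _ _ => gaussianPDFReal_nonneg _ _ _) z) hm.aestronglyMeasurable,
    lintegral_prod _ hm.ennreal_ofReal.aemeasurable]
  have hlin : ∀ f : ℝ → ℝ≥0∞, Measurable f → ∫⁻ x, f x ∂(gaussianReal 0 1)
      = ∫⁻ x, gaussianPDF 0 1 x * f x := fun f hf => by
    rw [gaussianReal_of_var_ne_zero 0 one_ne_zero,
      lintegral_withDensity_eq_lintegral_mul _ (measurable_gaussianPDF 0 1) hf]
    rfl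
  rw [hlin _ hm.ennreal_ofReal.lintegral_prod_right']
  have hinner : ∀ x : ℝ, gaussianPDF 0 1 x * ∫⁻ y, ENNReal.ofReal
      ({z : ℝ × ℝ | 0 < z.1 ∧ c * z.1 < z.2}.indicator
        (fun z => gaussianPDFReal 0 1 (g * z.1 + h * z.2)) (x, y)) ∂(gaussianReal 0 1)
      = (Ioi (0 : ℝ)).indicator (fun x => ENNReal.ofReal ((√(2 * Real.pi))⁻¹ ^ 3) *
        ∫⁻ y in Ioi (c * x), ENNReal.ofReal (Real.exp
          (-((1 + g ^ 2) * x ^ 2 + 2 * (g * h) * x * y + (1 + h ^ 2) * y ^ 2) / 2))) x := by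
    intro x
    by_cases hx : 0 < x
    · rw [indicator_of_mem (show x ∈ Ioi (0 : ℝ) from hx), hlin _ (by fun_prop), ← lintegral_indicator measurableSet_Ioi,
        ← lintegral_const_mul' _ _ ENNReal.ofReal_ne_top, ← lintegral_const_mul' _ _ gaussianPDF_ne_top]
      refine lintegral_congr fun y => ?_
      by_cases hy : c * x < y
      · rw [indicator_of_mem (show y ∈ Ioi (c * x) from hy), indicator_of_mem (by exact ⟨hx, hy⟩)]
        simp only [gaussianPDF]
        rw [← ENNReal.ofReal_mul (gaussianPDFReal_nonneg _ _ _), ← ENNReal.ofReal_mul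
          (gaussianPDFReal_nonneg _ _ _), ← ENNReal.ofReal_mul (by positivity)]
        congr 1
        simp only [gaussianPDFReal, sub_zero, NNReal.coe_one, mul_one]
        have he : Real.exp (-((1 + g ^ 2) * x ^ 2 + 2 * (g * h) * x * y + (1 + h ^ 2) * y ^ 2) / 2)
            = Real.exp (-x ^ 2 / 2) * (Real.exp (-y ^ 2 / 2) * Real.exp (-(g * x + h * y) ^ 2 / 2)) := by
          rw [← Real.exp_add, ← Real.exp_add]
          congr 1
          ring
        rw [he]
        ring
      · rw [indicator_of_notMem (show y ∉ Ioi (c * x) from hy), indicator_of_notMem (by exact fun H => hy H.2)]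
        simp
    · rw [indicator_of_notMem (show x ∉ Ioi (0 : ℝ) from hx)]
      simp [hx]
  simp_rw [hinner]
  rw [lintegral_indicator measurableSet_Ioi, lintegral_const_mul' _ _ ENNReal.ofReal_ne_top, key,
    ← ENNReal.ofReal_mul (by positivity), ENNReal.toReal_ofReal (by positivity)]

open Set in
/-- The first moment of a linear functional of a standard Gaussian vector over a simplicial cone
given in triangular coordinates. -/
theorem integral_indicator_cone_stdGaussian {r00 r10 r11 r20 r21 r22 : ℝ} (h00 : 0 < r00)
    (h11 : 0 < r11) (h22 : 0 < r22) (α β : ℝ) :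
    ∫ x, {x : EuclideanSpace ℝ (Fin 4) | 0 < r00 * x 0 ∧ 0 < r10 * x 0 + r11 * x 1 ∧
        0 < r20 * x 0 + r21 * x 1 + r22 * x 2}.indicator (fun x => α * x 2 + β * x 3) x
      ∂(stdGaussian (EuclideanSpace ℝ (Fin 4)))
    = α * ((√(2 * Real.pi))⁻¹ ^ 3 * ((Real.pi / 2 - Real.arctan
      (((1 + (r21 / r22) ^ 2) * (-(r10 / r11)) + (r20 / r22) * (r21 / r22)) /
        √(1 + (r20 / r22) ^ 2 + (r21 / r22) ^ 2))) / √(1 + (r20 / r22) ^ 2 + (r21 / r22) ^ 2))) := by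
  set γ := gaussianReal 0 1
  set S := {x : EuclideanSpace ℝ (Fin 4) | 0 < r00 * x 0 ∧ 0 < r10 * x 0 + r11 * x 1 ∧
        0 < r20 * x 0 + r21 * x 1 + r22 * x 2} with hS
  have hSm : MeasurableSet S :=
    (measurableSet_lt (f := fun _ => (0 : ℝ)) (g := fun x : EuclideanSpace ℝ (Fin 4) => r00 * x 0)
      (by fun_prop) (by fun_prop)).inter
    ((measurableSet_lt (f := fun _ => (0 : ℝ))
      (g := fun x : EuclideanSpace ℝ (Fin 4) => r10 * x 0 + r11 * x 1)
      (by fun_prop) (by fun_prop)).inter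
    (measurableSet_lt (f := fun _ => (0 : ℝ))
      (g := fun x : EuclideanSpace ℝ (Fin 4) => r20 * x 0 + r21 * x 1 + r22 * x 2)
      (by fun_prop) (by fun_prop)))
  have hFm : Measurable (S.indicator (fun x => α * x 2 + β * x 3)) :=
    Measurable.indicator (by fun_prop) hSm
  have hFi : Integrable (S.indicator (fun x => α * x 2 + β * x 3))
      (stdGaussian (EuclideanSpace ℝ (Fin 4))) := by
    refine Integrable.indicator ?_ hSm
    exact (((EuclideanSpace.proj (𝕜 := ℝ) (2 : Fin 4)).integrable_comp IsGaussian.integrable_id).const_mul α).add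
      (((EuclideanSpace.proj (𝕜 := ℝ) (3 : Fin 4)).integrable_comp IsGaussian.integrable_id).const_mul β)
  have hmp : MeasurePreserving (fun z : (ℝ × ℝ) × ℝ × ℝ => WithLp.toLp 2 ![z.1.1, z.1.2, z.2.1, z.2.2])
      ((γ.prod γ).prod (γ.prod γ)) (stdGaussian (EuclideanSpace ℝ (Fin 4))) :=
    MeasurePreserving.comp (g := WithLp.toLp 2) ⟨by fun_prop, map_pi_eq_stdGaussian⟩
      (measurePreserving_vecCons_four γ)
  have hFi' := (hmp.integrable_comp hFm.aestronglyMeasurable).2 hFi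
  rw [← hmp.map_eq, integral_map hmp.aemeasurable hFm.aestronglyMeasurable]
  simp only [Function.comp_def] at hFi'
  rw [integral_prod _ hFi', ← integral_sector_gaussianPDFReal, ← integral_const_mul]
  congr 1
  ext ⟨a, b⟩
  by_cases hab : 0 < a ∧ -(r10 / r11) * a < b
  · rw [indicator_of_mem (by exact hab)]
    have := integral_indicator_linear_gaussianReal α β (-((r20 / r22) * a + (r21 / r22) * b))
    have hsym : gaussianPDFReal 0 1 (-((r20 / r22) * a + (r21 / r22) * b))
        = gaussianPDFReal 0 1 ((r20 / r22) * a + (r21 / r22) * b) := by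
      simp only [gaussianPDFReal, sub_zero, neg_sq]
    rw [hsym] at this
    rw [← this]
    congr 1
    ext ⟨c, d⟩
    -- Over a point of the plane sector only the third cone inequality remains, and it is a lower
    -- bound on `c`.
    have hiff : WithLp.toLp 2 ![a, b, c, d] ∈ S ↔ -((r20 / r22) * a + (r21 / r22) * b) < c := by
      have h1 : 0 < r10 * a + r11 * b := by
        have := mul_lt_mul_of_pos_left hab.2 h11
        have e : r11 * (-(r10 / r11) * a) = - (r10 * a) := by field_simp
        linarith
      have e : r20 * a + r21 * b + r22 * c = r22 * (c - -((r20 / r22) * a + (r21 / r22) * b)) := by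
        field_simp; ring
      simp [hS, h1, h00, hab.1, e, h22]
    simp only [indicator, mem_ofPred_eq, hiff]
    simp
  · rw [indicator_of_notMem (by exact hab), mul_zero]
    rw [← integral_zero (ℝ × ℝ) ℝ (μ := γ.prod γ)]
    congr 1
    ext ⟨c, d⟩
    refine indicator_of_notMem (fun hmem => hab ?_) _
    have h0 : 0 < r00 * a := hmem.1
    have h1 : 0 < r10 * a + r11 * b := hmem.2.1
    refine ⟨pos_of_mul_pos_right h0 h00.le, ?_⟩
    have e : r10 * a + r11 * b = r11 * (b - -(r10 / r11) * a) := by field_simp; ring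
    rw [e] at h1
    linarith [pos_of_mul_pos_right h1 h11.le]

/-! ### Triangular coordinates for the covariance matrix -/

-- The rows of the symmetric square root of `L` serve as the vectors.
open scoped MatrixOrder in
theorem exists_linearIndependent_gram_eq {ι : Type*} [Fintype ι] [DecidableEq ι]
    {L : Matrix ι ι ℝ} (hL : L.PosDef) :
    ∃ b : ι → EuclideanSpace ℝ ι, LinearIndependent ℝ b ∧ ∀ i j, inner ℝ (b i) (b j) = L i j := by
  set B := CFC.sqrt L
  have hB : B * B = L := CFC.sqrt_mul_sqrt_self L hL.posSemidef.nonneg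
  have hsa : B.transpose = B := by
    have : star B = B := (CFC.sqrt_nonneg L).isSelfAdjoint
    simpa [Matrix.star_eq_conjTranspose] using this
  have hunit : IsUnit B := isUnit_of_mul_isUnit_left (hB ▸ hL.isUnit)
  refine ⟨fun i => WithLp.toLp 2 (B i), ?_, fun i j => ?_⟩
  · exact (Matrix.linearIndependent_rows_of_isUnit hunit).map'
      (WithLp.linearEquiv 2 ℝ (ι → ℝ)).symm.toLinearMap (LinearEquiv.ker _)
  · conv_rhs => rw [← hB]
    conv_rhs => arg 2; rw [← hsa]
    simp [PiLp.inner_apply, Matrix.mul_apply, mul_comm]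

/-- A positive definite `4 × 4` matrix is the Gram matrix of vectors whose differences with one of
them are in triangular position. -/
theorem exists_triangular_coordinates {L : Matrix (Fin 4) (Fin 4) ℝ} (hL : L.PosDef)
    {k l m n : Fin 4} (hkl : k ≠ l) (hkm : k ≠ m) (hkn : k ≠ n) (hlm : l ≠ m) (hln : l ≠ n)
    (hmn : m ≠ n) :
    ∃ V : Matrix (Fin 4) (Fin 4) ℝ, V * V.transpose = L ∧
      0 < V l 0 - V m 0 ∧ 0 < V l 1 - V n 1 ∧ 0 < V l 2 - V k 2 ∧ V l 3 ≠ 0 ∧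
      V m 1 = V l 1 ∧ V m 2 = V l 2 ∧ V m 3 = V l 3 ∧ V n 2 = V l 2 ∧ V n 3 = V l 3 ∧
      V k 3 = V l 3 := by
  obtain ⟨b, hb, hbL⟩ := exists_linearIndependent_gram_eq hL
  -- The edge to `k` comes third, so that the dual vector `Q` vanishes in the first two coordinates;
  -- `b l` completes the basis.
  let w : Fin 4 → EuclideanSpace ℝ (Fin 4) := ![b l - b m, b l - b n, b l - b k, b l]
  have hσ : Function.Injective ![m, n, k, l] := by
    intro i j
    fin_cases i <;> fin_cases j <;> simp [*, Ne.symm, eq_comm]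
  have hw : LinearIndependent ℝ w := by
    have hb' := Fintype.linearIndependent_iff.1 (hb.comp _ hσ)
    refine Fintype.linearIndependent_iff.2 fun g hg => ?_
    have := hb' ![-g 0, -g 1, -g 2, g 0 + g 1 + g 2 + g 3] (by
      rw [← hg]
      simp only [Fin.sum_univ_four, w, Function.comp]
      simp only [Matrix.cons_val]
      module)
    have h0 := this 0
    have h1 := this 1
    have h2 := this 2
    have h3 := this 3
    simp at h0 h1 h2 h3
    intro i
    fin_cases i <;> simp <;> linarith
  have hcard : Module.finrank ℝ (EuclideanSpace ℝ (Fin 4)) = Fintype.card (Fin 4) := by simp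
  let O := InnerProductSpace.gramSchmidtOrthonormalBasis hcard w
  have htri : ∀ i j, i < j → O.repr (w i) j = 0 := fun i j hij =>
    InnerProductSpace.gramSchmidtOrthonormalBasis_inv_triangular' hcard w hij
  have hdiag : ∀ i, O.repr (w i) i ≠ 0 := by
    have hdet : O.toBasis.det w ≠ 0 := by
      have := (O.toBasis.is_basis_iff_det (v := w)).1
        ⟨hw, hw.span_eq_top_of_card_eq_finrank hcard.symm⟩
      exact this.ne_zero
    rw [InnerProductSpace.gramSchmidtOrthonormalBasis_det] at hdet
    intro i
    rw [O.repr_apply_apply]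
    exact Finset.prod_ne_zero_iff.1 hdet i (Finset.mem_univ i)
  -- Reflecting axes makes the diagonal positive without changing inner products.
  let ε : Fin 4 → ℝ := fun i => SignType.sign (O.repr (w i) i)
  have hε : ∀ i, ε i * ε i = 1 := fun i => by
    rcases lt_or_gt_of_ne (hdiag i) with h | h <;> simp [ε, h]
  have hεpos : ∀ i, 0 < O.repr (w i) i * ε i := fun i => by
    rcases lt_or_gt_of_ne (hdiag i) with h | h <;> simp [ε, h]
  refine ⟨Matrix.of fun i j => O.repr (b i) j * ε j, ?_, ?_, ?_, ?_, ?_, ?_⟩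
  · ext i j
    rw [← hbL, ← O.repr.inner_map_map, PiLp.inner_apply, Matrix.mul_apply]
    refine Finset.sum_congr rfl fun a _ => ?_
    simp only [Matrix.transpose_apply, Matrix.of_apply, Real.inner_apply]
    linear_combination (O.repr (b i) a * O.repr (b j) a) * hε a
  · simpa [w, sub_mul] using hεpos 0
  · simpa [w, sub_mul] using hεpos 1
  · simpa [w, sub_mul] using hεpos 2
  · simpa [w] using (hεpos 3).ne'
  · have h01 := htri 0 1 (by decide)
    have h02 := htri 0 2 (by decide)
    have h03 := htri 0 3 (by decide)
    have h12 := htri 1 2 (by decide)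
    have h13 := htri 1 3 (by decide)
    have h23 := htri 2 3 (by decide)
    simp [w, sub_eq_zero] at h01 h02 h03 h12 h13 h23
    simp [← h01, ← h02, ← h03, ← h12, ← h13, ← h23]

/-! ### Moving a single covariance by moving one row -/

open Filter Topology in
/-- The small root `h(t)` of `s h² + 2 (1 + t p) h + t² q = 0`. -/
theorem exists_small_root (p q : ℝ) {s : ℝ} (hs : 0 < s) :
    ∃ h : ℝ → ℝ, h 0 = 0 ∧ HasDerivAt h 0 0 ∧
      ∀ᶠ t in 𝓝 0, s * h t ^ 2 + 2 * (1 + t * p) * h t + t ^ 2 * q = 0 := by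
  -- A quarter of the discriminant. The root with `+√D` vanishes at `0`, and its slope there is `(-p
  -- + p) / s = 0`.
  let D : ℝ → ℝ := fun t => (1 + t * p) ^ 2 - s * t ^ 2 * q
  have hD : HasDerivAt D (2 * p) 0 := by
    have h1 : HasDerivAt (fun t : ℝ => 1 + t * p) p 0 := by
      simpa using ((hasDerivAt_id (0 : ℝ)).mul_const p).const_add 1
    have h2 : HasDerivAt (fun t : ℝ => s * t ^ 2 * q) 0 0 := by
      simpa using (((hasDerivAt_pow 2 (0 : ℝ)).const_mul s).mul_const q)
    exact ((h1.pow 2).sub h2).congr_deriv (by simp)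
  have hD0 : D 0 = 1 := by simp [D]
  refine ⟨fun t => (-(1 + t * p) + √(D t)) / s, by simp [hD0], ?_, ?_⟩
  · have h1 : HasDerivAt (fun t : ℝ => -(1 + t * p)) (-p) 0 := by
      exact (((hasDerivAt_id (0 : ℝ)).mul_const p).const_add 1).neg.congr_deriv (by simp)
    refine ((h1.add (hD.sqrt (by simp [hD0]))).div_const s).congr_deriv ?_
    simp [hD0]
  · filter_upwards [hD.continuousAt.eventually (lt_mem_nhds (show (0 : ℝ) < D 0 by simp [hD0]))] with t ht
    have := Real.sq_sqrt (le_of_lt ht)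
    field_simp
    simp only [D] at this ⊢
    linear_combination this

/-- With `w = t Q + h S` one has `V w = t eₖ + h eₗ`, so adding `w` to row `l` changes the `(k, l)`
entry by `t` and the `(l, l)` entry by `2h + w · w`. The quadratic equation says exactly that the
latter is zero. -/
theorem updated_mul_transpose {ι : Type*} [Fintype ι] [DecidableEq ι] {V : Matrix ι ι ℝ}
    {k l : ι} {Q S : ι → ℝ} (hQ : V.mulVec Q = Pi.single k 1) (hS : V.mulVec S = Pi.single l 1)
    {t h : ℝ} (hh : (S ⬝ᵥ S) * h ^ 2 + 2 * (1 + t * (Q ⬝ᵥ S)) * h + t ^ 2 * (Q ⬝ᵥ Q) = 0) :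
    (V + Matrix.vecMulVec (Pi.single l 1) (t • Q + h • S)) *
        (V + Matrix.vecMulVec (Pi.single l 1) (t • Q + h • S)).transpose
      = V * V.transpose + t • (Matrix.single k l 1 + Matrix.single l k 1) := by
  have hv : V.mulVec (t • Q + h • S) = t • Pi.single k 1 + h • Pi.single l 1 := by
    rw [Matrix.mulVec_add, Matrix.mulVec_smul, Matrix.mulVec_smul, hQ, hS]
  have hvv : (t • Q + h • S) ⬝ᵥ (t • Q + h • S) = -(2 * h) := by
    simp only [add_dotProduct, dotProduct_add, smul_dotProduct, dotProduct_smul, smul_eq_mul]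
    rw [dotProduct_comm S Q]
    linear_combination hh
  rw [Matrix.transpose_add, Matrix.transpose_vecMulVec, Matrix.add_mul, Matrix.mul_add,
    Matrix.mul_add, Matrix.mul_vecMulVec, Matrix.vecMulVec_mul, Matrix.vecMul_transpose,
    Matrix.vecMulVec_mul_vecMulVec, hv, hvv]
  ext i j
  simp only [Matrix.add_apply, Matrix.vecMulVec_apply, Matrix.smul_apply, Matrix.single_apply,
    Pi.add_apply, Pi.smul_apply, Pi.single_apply, smul_eq_mul, eq_comm (a := k), eq_comm (a := l)]
  split_ifs <;> simp_all <;> ring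

open Filter Topology in
/-- The derivative of `F` at `V Vᵀ` in the direction of the entry `(k, l)`. -/
theorem hasDerivAt_gaussianMax {V : Matrix (Fin 4) (Fin 4) ℝ} {k l m n : Fin 4}
    (hmax : ∀ u : Fin 4 → ℝ, max (max (u 0) (u 1)) (max (u 2) (u 3))
      = max (u l) (max (u k) (max (u m) (u n))))
    (hkl : k ≠ l) (hml : m ≠ l) (hnl : n ≠ l)
    (hVk : V l ≠ V k) (hVm : V l ≠ V m) (hVn : V l ≠ V n)
    {Q S : Fin 4 → ℝ} (hQ : V.mulVec Q = Pi.single k 1) (hS : V.mulVec S = Pi.single l 1) :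
    HasDerivAt (fun t : ℝ => gaussianMax (V * V.transpose + t • entryDirection k l))
      (∫ x, {x : EuclideanSpace ℝ (Fin 4) | max (V k ⬝ᵥ x.ofLp) (max (V m ⬝ᵥ x.ofLp) (V n ⬝ᵥ x.ofLp))
          < V l ⬝ᵥ x.ofLp}.indicator (fun x => Q ⬝ᵥ x.ofLp) x
        ∂(stdGaussian (EuclideanSpace ℝ (Fin 4)))) 0 := by
  have hS0 : 0 < S ⬝ᵥ S := by
    have : S ≠ 0 := by
      rintro rfl
      simpa using congrFun hS l
    simpa using (Matrix.dotProduct_star_self_pos_iff (v := S)).2 this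
  obtain ⟨h, h0, hh, hroot⟩ := exists_small_root (Q ⬝ᵥ S) (Q ⬝ᵥ Q) hS0
  have hint : ∀ w : Fin 4 → ℝ, Integrable (fun x : EuclideanSpace ℝ (Fin 4) => w ⬝ᵥ x.ofLp)
      (stdGaussian (EuclideanSpace ℝ (Fin 4))) := fun w => by
    have := (innerSL ℝ (WithLp.toLp 2 w)).integrable_comp
      (IsGaussian.integrable_id (μ := stdGaussian (EuclideanSpace ℝ (Fin 4))))
    refine this.congr (ae_of_all _ fun x => ?_)
    simp [PiLp.inner_apply, dotProduct, mul_comm]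
  have hne : ∀ w : Fin 4 → ℝ, V l ≠ w → ∀ᵐ x : EuclideanSpace ℝ (Fin 4)
      ∂(stdGaussian (EuclideanSpace ℝ (Fin 4))), V l ⬝ᵥ x.ofLp ≠ w ⬝ᵥ x.ofLp := fun w hw => by
    have hw' : WithLp.toLp 2 (V l - w) ≠ 0 := by
      simpa [sub_eq_zero] using hw
    filter_upwards [ae_stdGaussian_inner_ne_zero hw'] with x hx heq
    apply hx
    have : inner ℝ (WithLp.toLp 2 (V l - w)) x = (V l - w) ⬝ᵥ x.ofLp := by
      simp [PiLp.inner_apply, dotProduct, mul_comm]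
    rw [this, sub_dotProduct, heq, sub_self]
  have key := hasDerivAt_integral_max (hint (V l)) (hint Q) (hint S)
    ((hint (V k)).sup ((hint (V m)).sup (hint (V n))))
    (by
      filter_upwards [hne _ hVk, hne _ hVm, hne _ hVn] with x h1 h2 h3
      simp only [Pi.sup_apply]
      rcases max_choice (V m ⬝ᵥ x.ofLp) (V n ⬝ᵥ x.ofLp) with e | e <;>
        rcases max_choice (V k ⬝ᵥ x.ofLp) (V m ⬝ᵥ x.ofLp ⊔ V n ⬝ᵥ x.ofLp) with e' | e' <;>
        rw [e'] <;> first | assumption | (rw [e]; assumption)) h0 hh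
  refine (key.congr_of_eventuallyEq ?_)
  filter_upwards [hroot] with t ht
  rw [entryDirection, ← updated_mul_transpose hQ hS ht, gaussianMax_mul_transpose]
  refine integral_congr_ae (ae_of_all _ fun x => ?_)
  have hrow : ∀ i, (V + Matrix.vecMulVec (Pi.single l 1) (t • Q + h t • S)).mulVec x.ofLp i
      = V i ⬝ᵥ x.ofLp + (if i = l then t * (Q ⬝ᵥ x.ofLp) + h t * (S ⬝ᵥ x.ofLp) else 0) := fun i => by
    rw [Matrix.add_mulVec, Matrix.vecMulVec_mulVec, add_dotProduct, smul_dotProduct, smul_dotProduct]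
    simp [Pi.single_apply, Matrix.mulVec]
  beta_reduce
  rw [hmax]
  simp only [hrow, hkl, hml, hnl, if_true, if_false, add_zero]
  rfl

/-! ### The volume term in terms of the entries -/

theorem inner_gaussianVertex {L : Matrix (Fin 4) (Fin 4) ℝ} (hL : L.PosSemidef) (i j : Fin 4) :
    inner ℝ (gaussianVertex L i) (gaussianVertex L j) = L i j := by
  rw [← covariance_eval_multivariateGaussian (μ := 0) hL i j,
    covariance_eq_sub (memLp_coord L i) (memLp_coord L j), L2.inner_def]
  have hmean : ∀ i, ∫ x : EuclideanSpace ℝ (Fin 4), x i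
      ∂(multivariateGaussian (0 : EuclideanSpace ℝ (Fin 4)) L) = 0 := fun i => by
    have := (EuclideanSpace.proj (𝕜 := ℝ) (i : Fin 4)).integral_comp_id_comm
      (IsGaussian.integrable_id (μ := multivariateGaussian (0 : EuclideanSpace ℝ (Fin 4)) L))
    simpa using this
  rw [hmean, zero_mul, sub_zero]
  refine integral_congr_ae ?_
  filter_upwards [(memLp_coord L i).coeFn_toLp, (memLp_coord L j).coeFn_toLp] with x hi hj
  simp only [gaussianVertex, hi, hj]
  simp [mul_comm]

/-- `Ã²` in terms of the entries `Λ'`. -/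
theorem tildeA_sq {L : Matrix (Fin 4) (Fin 4) ℝ} (hL : L ∈ UnitPosDef) :
    tildeA L ^ 2 = 2 * (Matrix.of fun i j : Fin 3 => primeEntry L i.succ 0 + primeEntry L j.succ 0
      - primeEntry L i.succ j.succ).det := by
  have h := sq_six_mul_tetrahedronVolume (gaussianVertex L)
  have hsymm : ∀ i j, L i j = L j i := fun i j => by
    simpa using (hL.1.1.apply i j).symm
  rw [tildeA, show (6 * √2 * tetrahedronVolume (gaussianVertex L)) ^ 2
    = √2 ^ 2 * (6 * tetrahedronVolume (gaussianVertex L)) ^ 2 by ring, h,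
    Real.sq_sqrt (by norm_num)]
  congr 2
  ext i j
  simp only [Matrix.gram_apply, Matrix.of_apply, inner_sub_left, inner_sub_right,
    inner_gaussianVertex hL.1.posSemidef, primeEntry, hL.2, hsymm 0]
  ring

/-- The two indices different from `k` and `l`. -/
theorem restMin_restMax_spec {k l : Fin 4} (hkl : k < l) :
    k ≠ restMin k l ∧ k ≠ restMax k l ∧ l ≠ restMin k l ∧ l ≠ restMax k l ∧
      restMin k l ≠ restMax k l := by
  revert k l
  decide

theorem max_eq_of_distinct {k l m n : Fin 4} (hkl : k ≠ l) (hkm : k ≠ m) (hkn : k ≠ n) (hlm : l ≠ m)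
    (hln : l ≠ n) (hmn : m ≠ n) (u : Fin 4 → ℝ) :
    max (max (u 0) (u 1)) (max (u 2) (u 3)) = max (u l) (max (u k) (max (u m) (u n))) := by
  have hcover : ∀ i, i = k ∨ i = l ∨ i = m ∨ i = n := by
    revert k l m n; decide
  apply le_antisymm
  · have : ∀ i, u i ≤ max (u l) (max (u k) (max (u m) (u n))) := fun i => by
      rcases hcover i with rfl | rfl | rfl | rfl <;> simp
    exact max_le (max_le (this 0) (this 1)) (max_le (this 2) (this 3))
  · have : ∀ i, u i ≤ max (max (u 0) (u 1)) (max (u 2) (u 3)) := fun i => by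
      fin_cases i <;> simp
    exact max_le (this l) (max_le (this k) (max_le (this m) (this n)))

/-- `Ã²` as a Gram determinant based at the vertex `l`. -/
theorem tildeA_sq_eq_of_distinct {L : Matrix (Fin 4) (Fin 4) ℝ} (hL : L ∈ UnitPosDef)
    {k l m n : Fin 4} (hkl : k ≠ l) (hkm : k ≠ m) (hkn : k ≠ n) (hlm : l ≠ m)
    (hln : l ≠ n) (hmn : m ≠ n) :
    tildeA L ^ 2 = 2 * (Matrix.det !![2 * primeEntry L l m,
        primeEntry L l m + primeEntry L l n - primeEntry L m n,
        primeEntry L l m + primeEntry L k l - primeEntry L k m;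
      primeEntry L l m + primeEntry L l n - primeEntry L m n, 2 * primeEntry L l n,
        primeEntry L l n + primeEntry L k l - primeEntry L k n;
      primeEntry L l m + primeEntry L k l - primeEntry L k m,
        primeEntry L l n + primeEntry L k l - primeEntry L k n, 2 * primeEntry L k l]) := by
  have hsymm : ∀ i j, primeEntry L i j = primeEntry L j i := fun i j => by
    simpa [primeEntry] using (hL.1.1.apply i j).symm
  have hdiag : ∀ i, primeEntry L i i = 0 := fun i => by simp [primeEntry, hL.2]
  rw [tildeA_sq hL]
  congr 1
  have e1 : (2 : Fin 3).succ = (3 : Fin 4) := rfl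
  have e2 : (1 : Fin 3).succ = (2 : Fin 4) := rfl
  have e3 : (0 : Fin 3).succ = (1 : Fin 4) := rfl
  simp only [Matrix.det_fin_three, Matrix.of_apply, Matrix.cons_val, e1, e2, e3, hdiag]
  -- The Gram determinant does not depend on the base vertex; this is checked as a polynomial
  -- identity for each of the 24 labelings.
  have h4 : ∀ i : Fin 4, i = 0 ∨ i = 1 ∨ i = 2 ∨ i = 3 := by decide
  rcases h4 k with rfl | rfl | rfl | rfl <;>
  rcases h4 l with rfl | rfl | rfl | rfl <;>
  try exact absurd rfl hkl
  all_goals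
    rcases h4 m with rfl | rfl | rfl | rfl <;>
    first | exact absurd rfl hkm | exact absurd rfl hlm | rcases h4 n with rfl | rfl | rfl | rfl
  all_goals
    first | exact absurd rfl hkn | exact absurd rfl hln | exact absurd rfl hmn | skip
  all_goals
    simp only [hsymm 1 0, hsymm 2 0, hsymm 3 0, hsymm 2 1, hsymm 3 1, hsymm 3 2]
    ring

/-! ### From the arctangent to the arccosine -/

/-- Both sides are the angle in `(0, π)` with cotangent `x / y`. -/
theorem pi_div_two_sub_arctan_div {x y : ℝ} (hy : 0 < y) :
    Real.pi / 2 - Real.arctan (x / y) = Real.arccos (x / √(y ^ 2 + x ^ 2)) := by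
  rw [Real.arctan_eq_arcsin, Real.arccos]
  congr 2
  have : √(y ^ 2 + x ^ 2) = y * √(1 + (x / y) ^ 2) := by
    rw [← Real.sqrt_sq hy.le, ← Real.sqrt_mul (sq_nonneg y), Real.sqrt_sq hy.le]
    congr 1
    field_simp
  rw [this, div_div]

open Real in
/-- The closed form of the orthant integral in triangular coordinates. -/
theorem neg_inv_mul_sector_eq_arccos {r00 r10 r11 r20 r21 r22 : ℝ} (h00 : 0 < r00)
    (h11 : 0 < r11) (h22 : 0 < r22) {P A T : ℝ} (hP : 2 * P = r20 ^ 2 + r21 ^ 2 + r22 ^ 2)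
    (hA : A ^ 2 = 2 * (r00 * r11 * r22) ^ 2)
    (hT : T = r00 * (r20 * r21 * r11 - r10 * (r21 ^ 2 + r22 ^ 2))) :
    -(1 / r22) * ((√(2 * π))⁻¹ ^ 3 * ((π / 2 - arctan
      (((1 + (r21 / r22) ^ 2) * (-(r10 / r11)) + (r20 / r22) * (r21 / r22)) /
        √(1 + (r20 / r22) ^ 2 + (r21 / r22) ^ 2))) / √(1 + (r20 / r22) ^ 2 + (r21 / r22) ^ 2)))
    = -(1 / (4 * √(π ^ 3 * P))) * arccos (T / √(P * A ^ 2 + T ^ 2)) := by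
  have hP0 : 0 < 2 * P := by rw [hP]; positivity
  -- In the application `R` is the length of the edge from `l` to `k`.
  set R := √(2 * P) with hR
  have hR0 : 0 < R := Real.sqrt_pos.2 hP0
  have hR2 : R ^ 2 = 2 * P := Real.sq_sqrt hP0.le
  have hδ : √(1 + (r20 / r22) ^ 2 + (r21 / r22) ^ 2) = R / r22 := by
    rw [Real.sqrt_eq_iff_mul_self_eq (by positivity) (by positivity), div_mul_div_comm, ← sq, hR2, hP]
    field_simp
    ring
  have hx : ((1 + (r21 / r22) ^ 2) * (-(r10 / r11)) + (r20 / r22) * (r21 / r22)) / (R / r22)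
      = T / (r00 * r11 * r22 * R) := by
    rw [hT]
    field_simp
    ring
  have hy : P * A ^ 2 = (r00 * r11 * r22 * R) ^ 2 := by
    rw [mul_pow _ R, hR2, hA]
    ring
  have hc : 4 * √(π ^ 3 * P) = √(2 * π) ^ 3 * R := by
    have h1 : √(π ^ 3 * P) * √(π ^ 3 * P) = π ^ 3 * P :=
      Real.mul_self_sqrt (by have := Real.pi_pos; have : 0 < P := by linarith
                             positivity)
    have h2 : √(2 * π) * √(2 * π) = 2 * π := Real.mul_self_sqrt (by positivity)
    have h3 : (4 * √(π ^ 3 * P)) ^ 2 = (√(2 * π) ^ 3 * R) ^ 2 := by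
      rw [mul_pow, mul_pow, hR2, sq √(π ^ 3 * P), h1,
        show (√(2 * π) ^ 3) ^ 2 = (√(2 * π) * √(2 * π)) ^ 3 by ring, h2]
      ring
    exact (pow_left_inj₀ (by positivity) (by positivity) two_ne_zero).1 h3
  rw [hδ, hx, pi_div_two_sub_arctan_div (by positivity), hy, hc]
  have : 0 < √(2 * π) := by positivity
  field_simp

/-- Unit variances give `‖Vᵢ - Vⱼ‖² = 2 - 2 Λᵢⱼ`; all geometric quantities are thereby polynomials
in edge coordinates. -/
theorem two_mul_primeEntry {L V : Matrix (Fin 4) (Fin 4) ℝ} (hL : L ∈ UnitPosDef)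
    (hV : V * V.transpose = L) (i j : Fin 4) :
    2 * primeEntry L i j = ∑ a, (V i a - V j a) ^ 2 := by
  have h : ∀ i j, L i j = ∑ a, V i a * V j a := fun i j => by
    rw [← hV, Matrix.mul_apply]; rfl
  have hi := (h i i).symm.trans (hL.2 i)
  have hj := (h j j).symm.trans (hL.2 j)
  rw [primeEntry, h i j]
  simp only [Fin.sum_univ_four] at hi hj ⊢
  linear_combination -hi - hj

/-! ### The derivative formula and its sign -/

theorem mainTheorem3 (L : Matrix (Fin 4) (Fin 4) ℝ) (hL : L ∈ UnitPosDef)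
    (k l : Fin 4) (hkl : k < l) :
    0 < primeEntry L k l ∧
    0 < primeEntry L k l * tildeA L ^ 2 + tildeEntry L k l ^ 2 ∧
    HasDerivAt (fun t : ℝ => gaussianMax (L + t • entryDirection k l))
      (-(1 / (4 * √(Real.pi ^ 3 * primeEntry L k l))) *
        Real.arccos (tildeEntry L k l /
          √(primeEntry L k l * tildeA L ^ 2 + tildeEntry L k l ^ 2))) 0 ∧
    deriv (fun t : ℝ => gaussianMax (L + t • entryDirection k l)) 0 < 0 := by
  obtain ⟨hkm, hkn, hlm, hln, hmn⟩ := restMin_restMax_spec hkl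
  have hT : tildeEntry L k l = primeEntry L k l ^ 2
    - primeEntry L k l * (primeEntry L k (restMin k l) + primeEntry L k (restMax k l)
      + primeEntry L l (restMin k l) + primeEntry L l (restMax k l)
      - 2 * primeEntry L (restMin k l) (restMax k l))
    + (primeEntry L k (restMin k l) - primeEntry L l (restMin k l))
      * (primeEntry L k (restMax k l) - primeEntry L l (restMax k l)) := rfl
  generalize restMin k l = m at *
  generalize restMax k l = n at *
  have hA := tildeA_sq_eq_of_distinct hL hkl.ne hkm hkn hlm hln hmn
  obtain ⟨V, hV, h00, h11, h22, h33, m1, m2, m3, n2, n3, k3⟩ :=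
    exists_triangular_coordinates hL.1 hkl.ne hkm hkn hlm hln hmn
  have hpe := two_mul_primeEntry hL hV
  -- Edge coordinates: `Vₗ - Vₘ = (r00, 0, 0, 0)`, `Vₗ - Vₙ = (r10, r11, 0, 0)`, `Vₗ - Vₖ = (r20,
  -- r21, r22, 0)`.
  obtain ⟨r00, e00⟩ : ∃ r, V m 0 = V l 0 - r := ⟨V l 0 - V m 0, by ring⟩
  obtain ⟨r10, e10⟩ : ∃ r, V n 0 = V l 0 - r := ⟨V l 0 - V n 0, by ring⟩
  obtain ⟨r11, e11⟩ : ∃ r, V n 1 = V l 1 - r := ⟨V l 1 - V n 1, by ring⟩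
  obtain ⟨r20, e20⟩ : ∃ r, V k 0 = V l 0 - r := ⟨V l 0 - V k 0, by ring⟩
  obtain ⟨r21, e21⟩ : ∃ r, V k 1 = V l 1 - r := ⟨V l 1 - V k 1, by ring⟩
  obtain ⟨r22, e22⟩ : ∃ r, V k 2 = V l 2 - r := ⟨V l 2 - V k 2, by ring⟩
  rw [e00, sub_sub_cancel] at h00
  rw [e11, sub_sub_cancel] at h11
  rw [e22, sub_sub_cancel] at h22
  have pkl : 2 * primeEntry L k l = r20 ^ 2 + r21 ^ 2 + r22 ^ 2 := by
    rw [hpe, Fin.sum_univ_four, e20, e21, e22, k3]; ring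
  have plm : primeEntry L l m = r00 ^ 2 / 2 := by
    have := hpe l m
    rw [Fin.sum_univ_four, e00, m1, m2, m3] at this
    linear_combination this / 2
  have pln : primeEntry L l n = (r10 ^ 2 + r11 ^ 2) / 2 := by
    have := hpe l n
    rw [Fin.sum_univ_four, e10, e11, n2, n3] at this
    linear_combination this / 2
  have pkm : primeEntry L k m = ((r20 - r00) ^ 2 + r21 ^ 2 + r22 ^ 2) / 2 := by
    have := hpe k m
    rw [Fin.sum_univ_four, e20, e21, e22, k3, e00, m1, m2, m3] at this
    linear_combination this / 2
  have pkn : primeEntry L k n = ((r20 - r10) ^ 2 + (r21 - r11) ^ 2 + r22 ^ 2) / 2 := by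
    have := hpe k n
    rw [Fin.sum_univ_four, e20, e21, e22, k3, e10, e11, n2, n3] at this
    linear_combination this / 2
  have pmn : primeEntry L m n = ((r10 - r00) ^ 2 + r11 ^ 2) / 2 := by
    have := hpe m n
    rw [Fin.sum_univ_four, e00, m1, m2, m3, e10, e11, n2, n3] at this
    linear_combination this / 2
  have pkl' : primeEntry L k l = (r20 ^ 2 + r21 ^ 2 + r22 ^ 2) / 2 := by linarith
  have hA' : tildeA L ^ 2 = 2 * (r00 * r11 * r22) ^ 2 := by
    rw [hA, Matrix.det_fin_three]
    simp only [Matrix.of_apply, Matrix.cons_val]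
    rw [pkl', plm, pln, pkm, pkn, pmn]
    ring
  have hT' : tildeEntry L k l = r00 * (r20 * r21 * r11 - r10 * (r21 ^ 2 + r22 ^ 2)) := by
    rw [hT, pkl', plm, pln, pkm, pkn, pmn]
    ring
  have hP0 : 0 < primeEntry L k l := by rw [pkl']; positivity
  have hPA : 0 < primeEntry L k l * tildeA L ^ 2 := by rw [hA']; positivity
  have hden : 0 < primeEntry L k l * tildeA L ^ 2 + tildeEntry L k l ^ 2 := by positivity
  have hunit : IsUnit V := isUnit_of_mul_isUnit_left (hV ▸ hL.1.isUnit)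
  obtain ⟨Q, hQ⟩ := (Matrix.mulVec_surjective_iff_isUnit.2 hunit) (Pi.single k 1)
  obtain ⟨S, hS⟩ := (Matrix.mulVec_surjective_iff_isUnit.2 hunit) (Pi.single l 1)
  have hder : HasDerivAt (fun t : ℝ => gaussianMax (L + t • entryDirection k l))
      (-(1 / (4 * √(Real.pi ^ 3 * primeEntry L k l))) *
        Real.arccos (tildeEntry L k l /
          √(primeEntry L k l * tildeA L ^ 2 + tildeEntry L k l ^ 2))) 0 := by
    have hd := hasDerivAt_gaussianMax (max_eq_of_distinct hkl.ne hkm hkn hlm hln hmn) hkl.ne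
      hlm.symm hln.symm (fun h => h22.ne' (by linarith [congrFun h 2]))
      (fun h => h00.ne' (by linarith [congrFun h 0]))
      (fun h => h11.ne' (by linarith [congrFun h 1])) hQ hS
    rw [hV] at hd
    convert hd using 1
    have qk := congrFun hQ k
    have ql := congrFun hQ l
    have qm := congrFun hQ m
    have qn := congrFun hQ n
    simp only [Matrix.mulVec, dotProduct, Fin.sum_univ_four, Pi.single_apply, hkl.ne', hkm.symm,
      hkn.symm, if_true, if_false, e00, e10, e11, e20, e21, e22, m1, m2, m3, n2, n3, k3]
      at qk ql qm qn
    -- Subtracting rows of `V Q = eₖ` makes `Q` orthogonal to the edges to `m` and `n`, with product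
    -- `-1` with the edge to `k`; the triangular system is solved forward. `Q 3` is not needed.
    have Q0 : Q 0 = 0 := by
      have : r00 * Q 0 = 0 := by linear_combination ql - qm
      exact (mul_eq_zero.1 this).resolve_left h00.ne'
    have Q1 : Q 1 = 0 := by
      have : r11 * Q 1 = 0 := by linear_combination ql - qn - r10 * Q0
      exact (mul_eq_zero.1 this).resolve_left h11.ne'
    have Q2 : Q 2 = -(1 / r22) := by
      have : r22 * Q 2 = -1 := by linear_combination ql - qk - r20 * Q0 - r21 * Q1
      field_simp
      linarith
    rw [← neg_inv_mul_sector_eq_arccos h00 h11 h22 pkl hA' hT', ← Q2,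
      ← integral_indicator_cone_stdGaussian h00 h11 h22 (Q 2) (Q 3)]
    congr 1
    ext x
    congr 1
    · ext x
      simp only [Set.mem_ofPred_eq, max_lt_iff, dotProduct, Fin.sum_univ_four, e00, e10, e11, e20,
        e21, e22, m1, m2, m3, n2, n3, k3]
      rw [← sub_pos (b := _ + _ + (V l 2 - r22) * _ + _)]
      constructor
      · rintro ⟨h1, h2, h3⟩
        exact ⟨by linarith, by linarith, by linarith⟩
      · rintro ⟨h1, h2, h3⟩
        exact ⟨by linarith, by linarith, by linarith⟩
    · ext x
      simp [dotProduct, Fin.sum_univ_four, Q0, Q1]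
  refine ⟨hP0, hden, hder, ?_⟩
  rw [hder.deriv]
  refine mul_neg_of_neg_of_pos (neg_lt_zero.2 (by have := Real.pi_pos; positivity)) ?_
  rw [Real.arccos_pos, div_lt_one (Real.sqrt_pos.2 hden)]
  -- The inequality is strict because `Λ'ₖₗ Ã² > 0`, so the arccosine is positive.
  exact Real.lt_sqrt_of_sq_lt (by linarith)
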